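/- Let $q_{MN}$ be a smooth Riemannian metric on the two-sphere $\mathbb{S}^2$ of constant positive scalar curvature $\mathcal{R}$ (a round sphere), and let $D$ be its Levi-Civita connection. Let $\mathscr{I}=\mathbb{R}\times\mathbb{S}^2$ (null infinity), with null coordinate $u\in\mathbb{R}$ and null normal $n=\partial_u$, each section $u=\mathrm{const}$ carrying the metric $q_{MN}$, which does not depend on $u$. Let $\sigma_{MN}$ be a smooth spatial symmetric tensor field on $\mathscr{I}$, that is, a symmetric bilinear form $\sigma(u,p)$ on $T_p\mathbb{S}^2$ for each $(u,p)\in\mathscr{I}$, depending smoothly on $(u,p)$. Suppose that $$\partial_n\sigma_{MN}=0,\qquad D_M\sigma_{NP}-D_N\sigma_{MP}=0,\qquad q^{MN}\sigma_{MN}=0 .$$ Then $\sigma_{MN}=0$ everywhere on $\mathscr{I}$. -/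

import Mathlib

open scoped Manifold ContDiff

namespace Scri

noncomputable section

/-- The two-sphere, with Mathlib's smooth structure. It models every section `u = const` of null
infinity, so that null infinity itself is `ℝ × S2`, the factor `ℝ` carrying the coordinate `u`
along the null normal `n = ∂_u`. -/
abbrev S2 : Type := Metric.sphere (0 : EuclideanSpace ℝ (Fin 3)) 1

/-- The model space of `S2`. -/
abbrev Plane : Type := EuclideanSpace ℝ (Fin 2)

/-- A Riemannian metric on the two-sphere, smooth as a section of the bundle of bilinear forms. -/
abbrev Metric2 : Type :=
  Bundle.ContMDiffRiemannianMetric (𝓡 2) ∞ Plane (fun p : S2 => TangentSpace (𝓡 2) p)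

/-- Bilinear forms on the tangent space at `p`. -/
abbrev BilinAt (p : S2) : Type :=
  TangentSpace (𝓡 2) p →L[ℝ] TangentSpace (𝓡 2) p →L[ℝ] ℝ

/-- A spatial tensor field `σ_{MN}` on null infinity `ℝ × S2`: at each `(u, p)` a bilinear form on
the tangent space of the section. -/
abbrev SpatialTensor : Type := (u : ℝ) → (p : S2) → BilinAt p

/-- Joint smoothness of a spatial tensor field in `(u, p)`. -/
def SpatialTensor.Smooth (σ : SpatialTensor) : Prop :=
  ContMDiff (𝓘(ℝ, ℝ).prod (𝓡 2)) ((𝓡 2).prod 𝓘(ℝ, Plane →L[ℝ] Plane →L[ℝ] ℝ)) ∞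
    (fun z : ℝ × S2 => (Bundle.TotalSpace.mk' (Plane →L[ℝ] Plane →L[ℝ] ℝ) z.2 (σ z.1 z.2) :
      Bundle.TotalSpace (Plane →L[ℝ] Plane →L[ℝ] ℝ) BilinAt))

/-- Smooth local coordinate systems `(ξ^1, ξ^2)` on the sphere. -/
def IsCoord (e : OpenPartialHomeomorph S2 Plane) : Prop :=
  e ∈ IsManifold.maximalAtlas (𝓡 2) ∞ S2

/-- The coordinate vector `∂/∂ξ^M` at the point of the sphere with coordinates `x`: the derivative of
the inverse chart applied to the `M`-th standard basis vector. The instance argument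
`chartedSpaceSelf` is the standard manifold structure of the plane. -/
def coordVec (e : OpenPartialHomeomorph S2 Plane) (M : Fin 2) (x : Plane) :
    TangentSpace (𝓡 2) (e.symm x) :=
  (@mfderiv ℝ _ Plane _ _ Plane _ (𝓡 2) Plane _ (chartedSpaceSelf Plane)
    Plane _ _ Plane _ (𝓡 2) S2 _ _ e.symm x :) (EuclideanSpace.single M (1 : ℝ) : Plane)

/-- Components `b_{MN}` of a field of bilinear forms in the coordinates `e`. -/
def comp (e : OpenPartialHomeomorph S2 Plane) (b : (p : S2) → BilinAt p)
    (M N : Fin 2) (x : Plane) : ℝ :=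
  b (e.symm x) (coordVec e M x) (coordVec e N x)

/-- The partial derivative `∂_M f`. -/
def pd (M : Fin 2) (f : Plane → ℝ) (x : Plane) : ℝ :=
  fderiv ℝ f x (EuclideanSpace.single M (1 : ℝ) : Plane)

variable (q : Metric2) (e : OpenPartialHomeomorph S2 Plane)

/-- The metric components `q_{MN}`. -/
def metricComp (M N : Fin 2) (x : Plane) : ℝ := comp e q.inner M N x

/-- The inverse metric components `q^{MN}`. -/
def invMetric (M N : Fin 2) (x : Plane) : ℝ :=
  (Matrix.of fun A B : Fin 2 => metricComp q e A B x)⁻¹ M N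

/-- The Christoffel symbols `Γ^L_{MN}` of the Levi-Civita connection of `q`. -/
def christoffel (L M N : Fin 2) (x : Plane) : ℝ :=
  (1 / 2 : ℝ) * ∑ P, invMetric q e L P x *
    (pd M (metricComp q e N P) x + pd N (metricComp q e M P) x - pd P (metricComp q e M N) x)

/-- The Ricci tensor
`∂_L Γ^L_{MN} - ∂_N Γ^L_{ML} + Γ^L_{LK} Γ^K_{MN} - Γ^L_{NK} Γ^K_{ML}` of `q`. -/
def ricci (M N : Fin 2) (x : Plane) : ℝ :=
  ∑ L, (pd L (christoffel q e L M N) x - pd N (christoffel q e L M L) x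
    + ∑ K, (christoffel q e L L K x * christoffel q e K M N x
      - christoffel q e L N K x * christoffel q e K M L x))

/-- The scalar curvature `q^{MN} R_{MN}`; it equals `2 / r ^ 2` on the round sphere of radius `r`. -/
def scalarCurvature (x : Plane) : ℝ := ∑ M, ∑ N, invMetric q e M N x * ricci q e M N x

/-- The components `D_M b_{NP}` of the Levi-Civita covariant derivative of `b`. -/
def covDeriv (b : (p : S2) → BilinAt p) (M N P : Fin 2) (x : Plane) : ℝ :=
  pd M (comp e b N P) x - ∑ L, christoffel q e L M N x * comp e b L P x
    - ∑ L, christoffel q e L M P x * comp e b N L x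

/-- The trace `q^{MN} b_{MN}`. -/
def trace (b : (p : S2) → BilinAt p) (x : Plane) : ℝ :=
  ∑ M, ∑ N, invMetric q e M N x * comp e b M N x

end

/-- `q` has constant scalar curvature equal to `R`. -/
def HasConstScalarCurvature (q : Metric2) (R : ℝ) : Prop :=
  ∀ e, IsCoord e → ∀ x ∈ e.target, scalarCurvature q e x = R

/-- `σ_{MN} = σ_{NM}`. -/
def SpatialTensor.IsSymm (σ : SpatialTensor) : Prop :=
  ∀ u p v w, σ u p v w = σ u p w v

/-- `∂_n σ_{MN} = 0`, where `n = ∂_u`. -/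
def SpatialTensor.NullDerivZero (σ : SpatialTensor) : Prop :=
  ∀ u p v w, HasDerivAt (fun t : ℝ => σ t p v w) 0 u

/-- `q^{MN} σ_{MN} = 0`. -/
def SpatialTensor.IsTraceless (σ : SpatialTensor) (q : Metric2) : Prop :=
  ∀ u e, IsCoord e → ∀ x ∈ e.target, trace q e (σ u) x = 0

/-- `D_M σ_{NP} - D_N σ_{MP} = 0`, where `D` is the Levi-Civita connection of `q`. -/
def SpatialTensor.IsCodazzi (σ : SpatialTensor) (q : Metric2) : Prop :=
  ∀ u e, IsCoord e → ∀ x ∈ e.target, ∀ M N P : Fin 2,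
    covDeriv q e (σ u) M N P x - covDeriv q e (σ u) N M P x = 0

end Scri

open scoped Manifold ContDiff

namespace Scri

/-! Each section is treated separately, by a Bochner argument combined with the maximum principle.
For a trace-free symmetric form s on a surface, f = -det s / det q equals |s|²/2; it does not depend
on the frame, so it is a continuous function on the sphere and attains its maximum by compactness.

Suppose f > 0 at a maximum. The Codazzi equation makes ∇s totally symmetric, and tracelessness makes
it trace-free. Such cubic forms in dimension two are determined by their contraction with a nonzero
trace-free s, and that contraction is df = 0; hence ∇s = 0 at the maximum (`cubic_eq_zero`).
Consequently the first partial derivatives of the components of ∇s are there the second covariant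
derivatives of s, and no |∇s|² term appears. Commuting derivatives by `ricci_identity` and using
tracelessness gives Δf = 2Rf > 0 (`bochner_algebra`), whereas the Hessian is negative semidefinite
at a maximum. This contradiction is `not_isLocalMax_of_codazzi`. So f ≤ 0 everywhere, and a
trace-free s with f ≤ 0 vanishes (`eq_zero_of_negDetRatio_nonpos`). -/

/-! ### Coordinate frames and smoothness of components. -/

/-- The inverse of a chart carries a constant vector field to a smooth vector field. -/
theorem contMDiffOn_mfderiv_symm_const {E M : Type*} [NormedAddCommGroup E] [NormedSpace ℝ E]
    [TopologicalSpace M] [ChartedSpace E M] [IsManifold 𝓘(ℝ, E) ∞ M]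
    {e : OpenPartialHomeomorph M E} (he : e ∈ IsManifold.maximalAtlas 𝓘(ℝ, E) ∞ M) (v : E) :
    haveI : IsManifold 𝓘(ℝ, E) 1 M := IsManifold.of_le (n := ∞) (by simp)
    ContMDiffOn 𝓘(ℝ, E) 𝓘(ℝ, E).tangent ∞
      (fun x : E => (Bundle.TotalSpace.mk' E (e.symm x) (mfderiv 𝓘(ℝ, E) 𝓘(ℝ, E) e.symm x v) :
        TangentBundle 𝓘(ℝ, E) M)) e.target := by
  have : IsManifold 𝓘(ℝ, E) 1 M := IsManifold.of_le (n := ∞) (by simp)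
  have h1 : ContMDiffOn 𝓘(ℝ, E) 𝓘(ℝ, E) ∞ e.symm e.target :=
    contMDiffOn_symm_of_mem_maximalAtlas he
  have h2 := h1.contMDiffOn_tangentMapWithin (m := ∞) (by simp) e.open_target.uniqueMDiffOn
  have h3 : ContMDiff 𝓘(ℝ, E) 𝓘(ℝ, E).tangent ∞
      (fun x : E => (Bundle.TotalSpace.mk' E x v : TangentBundle 𝓘(ℝ, E) E)) :=
    contMDiff_vectorSpace_iff_contDiff.mpr contDiff_const
  refine (h2.comp h3.contMDiffOn (s := e.target) (fun x hx => hx)).congr (fun x hx => ?_)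
  simp only [Function.comp, tangentMapWithin]
  rw [mfderivWithin_of_isOpen e.open_target hx]

theorem mfderiv_chart_symm_injective {E M : Type*} [NormedAddCommGroup E] [NormedSpace ℝ E]
    [TopologicalSpace M] [ChartedSpace E M]
    {e : OpenPartialHomeomorph M E} (he : e ∈ IsManifold.maximalAtlas 𝓘(ℝ, E) ∞ M)
    {x : E} (hx : x ∈ e.target) :
    Function.Injective (mfderiv 𝓘(ℝ, E) 𝓘(ℝ, E) e.symm x) := by
  have h : e.MDifferentiable 𝓘(ℝ, E) 𝓘(ℝ, E) :=
    ⟨(contMDiffOn_of_mem_maximalAtlas he).mdifferentiableOn (by simp),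
      (contMDiffOn_symm_of_mem_maximalAtlas he).mdifferentiableOn (by simp)⟩
  exact h.symm.mfderiv_injective hx

theorem contMDiffOn_coordVec {e : OpenPartialHomeomorph S2 Plane} (he : IsCoord e) (M : Fin 2) :
    ContMDiffOn 𝓘(ℝ, Plane) ((𝓡 2).prod 𝓘(ℝ, Plane)) ∞
      (fun x : Plane => (Bundle.TotalSpace.mk' Plane (e.symm x) (coordVec e M x) :
        TangentBundle (𝓡 2) S2)) e.target :=
  contMDiffOn_mfderiv_symm_const he _

theorem contDiffOn_comp {e : OpenPartialHomeomorph S2 Plane} (he : IsCoord e)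
    {b : (p : S2) → BilinAt p}
    (hb : ContMDiff (𝓡 2) ((𝓡 2).prod 𝓘(ℝ, Plane →L[ℝ] Plane →L[ℝ] ℝ)) ∞
      (fun p : S2 => (Bundle.TotalSpace.mk' (Plane →L[ℝ] Plane →L[ℝ] ℝ) p (b p) :
        Bundle.TotalSpace (Plane →L[ℝ] Plane →L[ℝ] ℝ) BilinAt))) (M N : Fin 2) :
    ContDiffOn ℝ ∞ (comp e b M N) e.target := by
  have h1 : ContMDiffOn 𝓘(ℝ, Plane) (𝓡 2) ∞ e.symm e.target :=
    contMDiffOn_symm_of_mem_maximalAtlas he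
  intro x hx
  have hM := contMDiffOn_coordVec he M x hx
  have hN := contMDiffOn_coordVec he N x hx
  have hb' := hb.contMDiffAt.comp_contMDiffWithinAt x (h1 x hx)
  have := ContMDiffWithinAt.clm_bundle_apply₂ (F₁ := Plane) (F₂ := Plane) (F₃ := ℝ)
    (E₃ := Bundle.Trivial S2 ℝ) hb' hM hN
  rw [Bundle.contMDiffWithinAt_totalSpace] at this
  exact this.2.contDiffWithinAt

theorem SpatialTensor.Smooth.contMDiff {σ : SpatialTensor} (h : σ.Smooth) (u : ℝ) :
    ContMDiff (𝓡 2) ((𝓡 2).prod 𝓘(ℝ, Plane →L[ℝ] Plane →L[ℝ] ℝ)) ∞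
      (fun p : S2 => (Bundle.TotalSpace.mk' (Plane →L[ℝ] Plane →L[ℝ] ℝ) p (σ u p) :
        Bundle.TotalSpace (Plane →L[ℝ] Plane →L[ℝ] ℝ) BilinAt)) :=
  ContMDiff.comp (g := fun z : ℝ × S2 =>
    (Bundle.TotalSpace.mk' (Plane →L[ℝ] Plane →L[ℝ] ℝ) z.2 (σ z.1 z.2) :
      Bundle.TotalSpace (Plane →L[ℝ] Plane →L[ℝ] ℝ) BilinAt)) h
    (contMDiff_const.prodMk contMDiff_id)

theorem coordVec_linearIndependent {e : OpenPartialHomeomorph S2 Plane} (he : IsCoord e)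
    {x : Plane} (hx : x ∈ e.target) {a b : ℝ}
    (h : a • coordVec e 0 x + b • coordVec e 1 x = 0) : a = 0 ∧ b = 0 := by
  have h5 : mfderiv 𝓘(ℝ, Plane) (𝓡 2) e.symm x
      (a • EuclideanSpace.single 0 (1 : ℝ) + b • EuclideanSpace.single 1 (1 : ℝ) : Plane) = 0 := by
    rw [← h]
    exact (map_add _ _ _).trans (congrArg₂ _ (map_smul _ _ _) (map_smul _ _ _))
  have h6 : (a • EuclideanSpace.single 0 (1 : ℝ) + b • EuclideanSpace.single 1 (1 : ℝ) : Plane)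
      = 0 :=
    mfderiv_chart_symm_injective he hx (h5.trans (map_zero _).symm)
  exact ⟨by simpa using congrArg (fun v : Plane => v 0) h6,
    by simpa using congrArg (fun v : Plane => v 1) h6⟩

/-! ### Calculus of coordinate partial derivatives; the second-derivative test. -/

section PartialDerivatives

variable {f g : Plane → ℝ} {x : Plane} {U : Set Plane}

theorem pd_mul (M : Fin 2) (hf : DifferentiableAt ℝ f x) (hg : DifferentiableAt ℝ g x) :
    pd M (fun y => f y * g y) x = pd M f x * g x + f x * pd M g x := by
  simp only [pd]
  rw [fderiv_fun_mul hf hg]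
  simp
  ring

theorem pd_add (M : Fin 2) (hf : DifferentiableAt ℝ f x) (hg : DifferentiableAt ℝ g x) :
    pd M (fun y => f y + g y) x = pd M f x + pd M g x := by
  simp only [pd]
  rw [fderiv_fun_add hf hg]
  rfl

theorem pd_sub (M : Fin 2) (hf : DifferentiableAt ℝ f x) (hg : DifferentiableAt ℝ g x) :
    pd M (fun y => f y - g y) x = pd M f x - pd M g x := by
  simp only [pd]
  rw [fderiv_fun_sub hf hg]
  rfl

theorem pd_const (M : Fin 2) (c : ℝ) : pd M (fun _ => c) x = 0 := by
  simp [pd]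

theorem pd_congr (M : Fin 2) (hU : IsOpen U) (hx : x ∈ U) (h : ∀ y ∈ U, f y = g y) :
    pd M f x = pd M g x := by
  simp only [pd]
  rw [Filter.EventuallyEq.fderiv_eq]
  filter_upwards [hU.mem_nhds hx] with y hy using h y hy

theorem contDiffOn_pd (hU : IsOpen U) (hf : ContDiffOn ℝ ∞ f U) (M : Fin 2) :
    ContDiffOn ℝ ∞ (pd M f) U :=
  (hf.fderiv_of_isOpen hU (by simp)).clm_apply contDiffOn_const

theorem differentiableAt_of_contDiffOn (hU : IsOpen U) (hx : x ∈ U) (hf : ContDiffOn ℝ ∞ f U) :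
    DifferentiableAt ℝ f x :=
  (hf.contDiffAt (hU.mem_nhds hx)).differentiableAt (by simp)

theorem pd_pd_eq (hU : IsOpen U) (hx : x ∈ U) (hf : ContDiffOn ℝ ∞ f U) (M N : Fin 2) :
    pd M (pd N f) x = fderiv ℝ (fderiv ℝ f) x (EuclideanSpace.single M (1 : ℝ))
      (EuclideanSpace.single N (1 : ℝ)) := by
  have h : DifferentiableAt ℝ (fderiv ℝ f) x :=
    ((hf.fderiv_of_isOpen hU (m := ∞) (by simp)).contDiffAt
      (hU.mem_nhds hx)).differentiableAt (by simp)
  unfold pd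
  rw [fderiv_clm_apply h (differentiableAt_const _)]
  simp

theorem pd_comm (hU : IsOpen U) (hx : x ∈ U) (hf : ContDiffOn ℝ ∞ f U) (M N : Fin 2) :
    pd M (pd N f) x = pd N (pd M f) x := by
  rw [pd_pd_eq hU hx hf, pd_pd_eq hU hx hf]
  exact ((hf.contDiffAt (hU.mem_nhds hx)).isSymmSndFDerivAt (by
    simp only [minSmoothness_of_isRCLikeNormedField]; exact WithTop.coe_le_coe.mpr le_top)) _ _

theorem pd_eq_zero_of_isLocalMax (h : IsLocalMax f x) (M : Fin 2) : pd M f x = 0 := by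
  simp [pd, h.fderiv_eq_zero]

/-- The Hessian at a local maximum is negative semidefinite. -/
theorem hessian_nonpos_of_isLocalMax (hU : IsOpen U) (hx : x ∈ U) (hf : ContDiffOn ℝ ∞ f U)
    (h : IsLocalMax f x) (w : Fin 2 → ℝ) :
    ∑ L, ∑ K, w L * w K * pd L (pd K f) x ≤ 0 := by
  set v : Plane := ∑ L, w L • EuclideanSpace.single L (1 : ℝ) with hv
  have hsum : ∑ L, ∑ K, w L * w K * pd L (pd K f) x = fderiv ℝ (fderiv ℝ f) x v v := by
    simp only [pd_pd_eq hU hx hf, hv, Fin.sum_univ_two, map_add, map_smul,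
      add_apply, smul_apply, smul_eq_mul]
    ring
  rw [hsum]
  have hl : ∀ t : ℝ, HasDerivAt (fun t : ℝ => x + t • v) v t := fun t => by
    simpa using ((hasDerivAt_id t).smul_const v).const_add x
  have hcont : Continuous (fun t : ℝ => x + t • v) := by fun_prop
  have hnhds : ∀ᶠ t in nhds (0 : ℝ), x + t • v ∈ U :=
    hcont.continuousAt.eventually_mem (by simpa using hU.mem_nhds hx)
  set φ : ℝ → ℝ := fun t => f (x + t • v) with hφ
  have hd : deriv φ =ᶠ[nhds 0] fun t => fderiv ℝ f (x + t • v) v := by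
    filter_upwards [hnhds] with t ht
    exact ((differentiableAt_of_contDiffOn hU ht hf).hasFDerivAt.comp_hasDerivAt t (hl t)).deriv
  have hdiff : DifferentiableAt ℝ (fderiv ℝ f) x :=
    ((hf.fderiv_of_isOpen hU (m := ∞) (by simp)).contDiffAt
      (hU.mem_nhds hx)).differentiableAt (by simp)
  have hdd : deriv (deriv φ) 0 = fderiv ℝ (fderiv ℝ f) x v v := by
    rw [hd.deriv_eq]
    have h1 : HasFDerivAt (fderiv ℝ f) (fderiv ℝ (fderiv ℝ f) x) (x + (0 : ℝ) • v) := by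
      simpa using hdiff.hasFDerivAt
    have h2 := h1.comp_hasDerivAt (0 : ℝ) (hl 0)
    exact (h2.clm_apply (hasDerivAt_const (0 : ℝ) v)).deriv.trans (by simp)
  rw [← hdd]
  -- A positive second derivative would make 0 a local minimum of `φ` as well as a local maximum.
  -- Then `φ` is locally constant and its second derivative is 0.
  by_contra hpos
  rw [not_le] at hpos
  have hmax : IsLocalMax φ 0 := by
    have h' : IsLocalMax f (x + (0 : ℝ) • v) := by simpa using h
    exact h'.comp_continuous (g := fun t : ℝ => x + t • v) hcont.continuousAt
  have hmin : IsLocalMin φ 0 :=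
    isLocalMin_of_deriv_deriv_pos hpos hmax.deriv_eq_zero (by
      have h' : ContinuousAt f (x + (0 : ℝ) • v) := by
        simpa using (differentiableAt_of_contDiffOn hU hx hf).continuousAt
      exact h'.comp (f := fun t : ℝ => x + t • v) hcont.continuousAt)
  have hconst : φ =ᶠ[nhds 0] fun _ => φ 0 := by
    filter_upwards [hmax, hmin] with t h1 h2 using le_antisymm h1 h2
  have h0 : deriv φ =ᶠ[nhds 0] fun _ => (0 : ℝ) := by
    simpa using hconst.deriv
  rw [h0.deriv_eq] at hpos
  simp at hpos

end PartialDerivatives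

/-! ### Covariant derivatives of 2-tensors and the Ricci identity. -/

section Connection

/-- The covariant derivative `∇_K b_{MN}` of a 2-tensor for the connection coefficients
`G L M N = Γ^L_{MN}`. -/
noncomputable def covDer (G : Fin 2 → Fin 2 → Fin 2 → Plane → ℝ) (b : Fin 2 → Fin 2 → Plane → ℝ)
    (K M N : Fin 2) (x : Plane) : ℝ :=
  pd K (b M N) x - ∑ L, G L K M x * b L N x - ∑ L, G L K N x * b M L x

/-- The curvature component `R^L_{M01}` of a connection on the plane. -/
noncomputable def curv (G : Fin 2 → Fin 2 → Fin 2 → Plane → ℝ) (L M : Fin 2) (x : Plane) : ℝ :=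
  pd 0 (G L 1 M) x - pd 1 (G L 0 M) x + ∑ K, (G L 0 K x * G K 1 M x - G L 1 K x * G K 0 M x)

variable {U : Set Plane} {x : Plane} {G : Fin 2 → Fin 2 → Fin 2 → Plane → ℝ}
  {b : Fin 2 → Fin 2 → Plane → ℝ}

theorem contDiffOn_covDer (hU : IsOpen U) (hG : ∀ L M N, ContDiffOn ℝ ∞ (G L M N) U)
    (hb : ∀ M N, ContDiffOn ℝ ∞ (b M N) U) (K M N : Fin 2) :
    ContDiffOn ℝ ∞ (covDer G b K M N) U :=
  ((contDiffOn_pd hU (hb M N) K).sub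
    (ContDiffOn.sum fun L _ => (hG L K M).mul (hb L N))).sub
    (ContDiffOn.sum fun L _ => (hG L K N).mul (hb M L))

/-- The product rule for a covariant derivative vanishing at a point. -/
theorem pd_covDer (hU : IsOpen U) (hx : x ∈ U) (hG : ∀ L M N, ContDiffOn ℝ ∞ (G L M N) U)
    (hb : ∀ M N, ContDiffOn ℝ ∞ (b M N) U) (J K M N : Fin 2) :
    pd J (covDer G b K M N) x = pd J (pd K (b M N)) x
      - ∑ L, (pd J (G L K M) x * b L N x + G L K M x * pd J (b L N) x)
      - ∑ L, (pd J (G L K N) x * b M L x + G L K N x * pd J (b M L) x) := by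
  have dG := fun L M N => differentiableAt_of_contDiffOn hU hx (hG L M N)
  have db := fun M N => differentiableAt_of_contDiffOn hU hx (hb M N)
  have dpb := fun K M N => differentiableAt_of_contDiffOn hU hx (contDiffOn_pd hU (hb M N) K)
  have e1 : covDer G b K M N = fun y => pd K (b M N) y
      - (G 0 K M y * b 0 N y + G 1 K M y * b 1 N y)
      - (G 0 K N y * b M 0 y + G 1 K N y * b M 1 y) := by
    funext y; simp [covDer, Fin.sum_univ_two]
  have m1 := fun L N => (dG L K M).fun_mul (db L N)
  have m2 := fun L => (dG L K N).fun_mul (db M L)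
  rw [e1, pd_sub _ ((dpb K M N).fun_sub ((m1 0 N).fun_add (m1 1 N))) ((m2 0).fun_add (m2 1)),
    pd_sub _ (dpb K M N) ((m1 0 N).fun_add (m1 1 N)),
    pd_add _ (m1 0 N) (m1 1 N), pd_add _ (m2 0) (m2 1), pd_mul _ (dG _ _ _) (db _ _),
    pd_mul _ (dG _ _ _) (db _ _), pd_mul _ (dG _ _ _) (db _ _), pd_mul _ (dG _ _ _) (db _ _)]
  simp only [Fin.sum_univ_two]

/-- The Ricci identity at a zero of the covariant derivative. -/
theorem ricci_identity (hU : IsOpen U) (hx : x ∈ U) (hG : ∀ L M N, ContDiffOn ℝ ∞ (G L M N) U)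
    (hb : ∀ M N, ContDiffOn ℝ ∞ (b M N) U) (h0 : ∀ K M N, covDer G b K M N x = 0) (M N : Fin 2) :
    pd 0 (covDer G b 1 M N) x - pd 1 (covDer G b 0 M N) x =
      - ∑ L, (curv G L M x * b L N x + curv G L N x * b M L x) := by
  have h (K M N : Fin 2) : pd K (b M N) x =
      G 0 K M x * b 0 N x + G 1 K M x * b 1 N x + (G 0 K N x * b M 0 x + G 1 K N x * b M 1 x) := by
    have := h0 K M N
    simp only [covDer, Fin.sum_univ_two] at this
    linarith
  rw [pd_covDer hU hx hG hb, pd_covDer hU hx hG hb, pd_comm hU hx (hb M N) 1 0]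
  simp only [Fin.sum_univ_two, curv, h]
  ring

end Connection

/-! ### Pointwise algebra of trace-free Codazzi tensors in dimension two. -/

section TracelessCodazzi

/-- A trilinear totally symmetric form with vanishing contraction with a metric `g` and with a
nonzero trace-free form `s` is zero. -/
theorem cubic_eq_zero {g₀ g₁ g₂ s₀ s₁ s₂ a b c d : ℝ}
    (hD : 0 < g₀ * g₂ - g₁ ^ 2) (hF : 0 < s₁ ^ 2 - s₀ * s₂)
    (htr : g₂ * s₀ - 2 * g₁ * s₁ + g₀ * s₂ = 0)
    (h1 : g₂ * a - 2 * g₁ * b + g₀ * c = 0) (h2 : g₂ * b - 2 * g₁ * c + g₀ * d = 0)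
    (h3 : s₂ * a - 2 * s₁ * b + s₀ * c = 0) (h4 : s₂ * b - 2 * s₁ * c + s₀ * d = 0) :
    a = 0 ∧ b = 0 ∧ c = 0 ∧ d = 0 := by
  have hne : 4 * ((g₀ * g₂ - g₁ ^ 2) * (s₁ ^ 2 - s₀ * s₂)) ≠ 0 :=
    (mul_pos four_pos (mul_pos hD hF)).ne'
  have g₀_ne : g₀ ≠ 0 := by rintro rfl; nlinarith [sq_nonneg g₁]
  have g₂_ne : g₂ ≠ 0 := by rintro rfl; nlinarith [sq_nonneg g₁]
  -- Eliminating `a` and `d` leaves a 2 × 2 linear system in `b`, `c`. Its determinant is, up to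
  -- sign, the number in `hne` plus the square of the left side of `htr`.
  have e1 : -2 * (g₁ * s₂ - g₂ * s₁) * b + (g₀ * s₂ - g₂ * s₀) * c = 0 := by
    linear_combination s₂ * h1 - g₂ * h3
  have e2 : -(g₀ * s₂ - g₂ * s₀) * b + 2 * (g₀ * s₁ - g₁ * s₀) * c = 0 := by
    linear_combination s₀ * h2 - g₀ * h4
  have hb : b = 0 := (mul_eq_zero_iff_left hne).mp (by
    linear_combination 2 * (g₀ * s₁ - g₁ * s₀) * e1 - (g₀ * s₂ - g₂ * s₀) * e2
      - b * (g₂ * s₀ - 2 * g₁ * s₁ + g₀ * s₂) * htr)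
  have hc : c = 0 := (mul_eq_zero_iff_left hne).mp (by
    linear_combination (g₀ * s₂ - g₂ * s₀) * e1 - 2 * (g₁ * s₂ - g₂ * s₁) * e2
      - c * (g₂ * s₀ - 2 * g₁ * s₁ + g₀ * s₂) * htr)
  subst hb hc
  exact ⟨(mul_eq_zero_iff_left g₂_ne).mp (by linear_combination h1), rfl, rfl,
    (mul_eq_zero_iff_left g₀_ne).mp (by linear_combination h2)⟩

/-- The Bochner identity for a trace-free Codazzi tensor `s` at a zero of `∇s`, where
`a L, b L, c L, d L` are the components `000, 001, 011, 111` of `∂_L ∇s` and `W L M` is the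
curvature `R^L_{M01}`. -/
theorem bochner_algebra {g₀ g₁ g₂ s₀ s₁ s₂ R : ℝ} {a b c d : Fin 2 → ℝ} {W : Fin 2 → Fin 2 → ℝ}
    (hD : g₀ * g₂ - g₁ ^ 2 ≠ 0) (htr : g₂ * s₀ - 2 * g₁ * s₁ + g₀ * s₂ = 0)
    (h1 : ∀ L, g₂ * a L - 2 * g₁ * b L + g₀ * c L = 0)
    (h2 : ∀ L, g₂ * b L - 2 * g₁ * c L + g₀ * d L = 0)
    (hW0 : W 0 0 * g₀ + W 1 0 * g₁ = 0)
    (hW1 : W 0 0 * g₁ + W 1 0 * g₂ + (W 0 1 * g₀ + W 1 1 * g₁) = 0)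
    (hW2 : W 0 1 * g₁ + W 1 1 * g₂ = 0)
    (hR : -g₂ * W 1 0 - g₁ * (W 0 0 - W 1 1) + g₀ * W 0 1 = R * (g₀ * g₂ - g₁ ^ 2))
    (hk0 : b 0 - a 1 = -2 * (W 0 0 * s₀ + W 1 0 * s₁))
    (hk1 : c 0 - b 1 = -(W 0 0 * s₁ + W 1 0 * s₂ + (W 0 1 * s₀ + W 1 1 * s₁)))
    (hk2 : d 0 - c 1 = -2 * (W 0 1 * s₁ + W 1 1 * s₂)) :
    g₂ * (2 * s₁ * b 0 - s₀ * c 0 - s₂ * a 0)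
      - g₁ * (2 * s₁ * c 0 - s₀ * d 0 - s₂ * b 0 + (2 * s₁ * b 1 - s₀ * c 1 - s₂ * a 1))
      + g₀ * (2 * s₁ * c 1 - s₀ * d 1 - s₂ * b 1)
      = 2 * R * ((g₀ * g₂ - g₁ ^ 2) * (s₁ ^ 2 - s₀ * s₂)) := by
  -- `hW0`, `hW1`, `hW2` say that the curvature with its upper index lowered is skew, so one
  -- component remains and `hR` fixes it: Gauss curvature R/2 times the area form. Raising the index
  -- gives all entries of `W`.
  have hω : W 0 0 * g₁ + W 1 0 * g₂ = -(R / 2) * (g₀ * g₂ - g₁ ^ 2) := by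
    linear_combination hW1 / 2 - hR / 2
  have hω' : W 0 1 * g₀ + W 1 1 * g₁ = R / 2 * (g₀ * g₂ - g₁ ^ 2) := by
    linear_combination hW1 / 2 + hR / 2
  have w00 : W 0 0 = g₁ * R / 2 := mul_right_cancel₀ hD (by
    linear_combination g₂ * hW0 - g₁ * hω)
  have w10 : W 1 0 = -g₀ * R / 2 := mul_right_cancel₀ hD (by
    linear_combination g₀ * hω - g₁ * hW0)
  have w01 : W 0 1 = g₂ * R / 2 := mul_right_cancel₀ hD (by
    linear_combination g₂ * hω' - g₁ * hW2)
  have w11 : W 1 1 = -g₁ * R / 2 := mul_right_cancel₀ hD (by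
    linear_combination g₀ * hW2 - g₁ * hω')
  rw [w00, w10] at hk0
  rw [w00, w10, w01, w11] at hk1
  rw [w01, w11] at hk2
  -- The differentiated trace conditions and the commutators remove all second derivatives. The
  -- curvature terms that remain exceed the right side by R/2 times the square of the trace
  -- expression, which `htr` cancels.
  linear_combination -s₂ * h1 0 + 2 * s₁ * h2 0 - s₀ * h2 1
    + (-s₂ * g₁) * hk0 + (s₂ * g₀ + 2 * s₁ * g₁ - s₀ * g₂) * hk1 + (-2 * s₁ * g₀ + s₀ * g₁) * hk2
    + R / 2 * (g₂ * s₀ - 2 * g₁ * s₁ + g₀ * s₂) * htr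

end TracelessCodazzi

/-! ### The maximum principle in a chart. -/

/-- A single template for differentiating both the trace condition and the formula for df, each a
signed sum of three products. -/
theorem pd_combination {x : Plane} {u v w p q r : Plane → ℝ}
    (hu : DifferentiableAt ℝ u x) (hv : DifferentiableAt ℝ v x) (hw : DifferentiableAt ℝ w x)
    (hp : DifferentiableAt ℝ p x) (hq : DifferentiableAt ℝ q x) (hr : DifferentiableAt ℝ r x)
    (L : Fin 2) :
    pd L (fun y => u y * p y - v y * q y - w y * r y) x =
      (pd L u x * p x + u x * pd L p x) - (pd L v x * q x + v x * pd L q x)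
        - (pd L w x * r x + w x * pd L r x) := by
  rw [pd_sub _ ((hu.fun_mul hp).fun_sub (hv.fun_mul hq)) (hw.fun_mul hr),
    pd_sub _ (hu.fun_mul hp) (hv.fun_mul hq), pd_mul _ hu hp, pd_mul _ hv hq, pd_mul _ hw hr]

theorem pd_const_mul {x : Plane} {f : Plane → ℝ} (L : Fin 2) (a : ℝ)
    (hf : DifferentiableAt ℝ f x) : pd L (fun y => a * f y) x = a * pd L f x := by
  rw [pd_mul _ (differentiableAt_const _) hf, pd_const]; ring

/-- Local form of the vanishing theorem: in positive curvature, the ratio of determinants of a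
trace-free Codazzi tensor and the metric has no local extremum where the tensor is nonzero. -/
theorem not_isLocalMax_of_codazzi {U : Set Plane} {x₀ : Plane}
    {G : Fin 2 → Fin 2 → Fin 2 → Plane → ℝ} {g s : Fin 2 → Fin 2 → Plane → ℝ} {R : ℝ}
    (hU : IsOpen U) (hx₀ : x₀ ∈ U) (hG : ∀ L M N, ContDiffOn ℝ ∞ (G L M N) U)
    (hg : ∀ M N, ContDiffOn ℝ ∞ (g M N) U) (hs : ∀ M N, ContDiffOn ℝ ∞ (s M N) U)
    (hgs : g 1 0 = g 0 1) (hss : s 1 0 = s 0 1)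
    (hcompat : ∀ y ∈ U, ∀ K M N, covDer G g K M N y = 0)
    (hcod : ∀ y ∈ U, ∀ M N P, covDer G s M N P y = covDer G s N M P y)
    (hpos : 0 < g 0 0 x₀) (hD : ∀ y ∈ U, 0 < g 0 0 y * g 1 1 y - g 0 1 y ^ 2)
    (htr : ∀ y ∈ U, g 1 1 y * s 0 0 y - 2 * g 0 1 y * s 0 1 y + g 0 0 y * s 1 1 y = 0)
    (hric : -g 1 1 x₀ * curv G 1 0 x₀ - g 0 1 x₀ * (curv G 0 0 x₀ - curv G 1 1 x₀)
      + g 0 0 x₀ * curv G 0 1 x₀ = R * (g 0 0 x₀ * g 1 1 x₀ - g 0 1 x₀ ^ 2)) (hR : 0 < R)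
    (hF : 0 < s 0 1 x₀ ^ 2 - s 0 0 x₀ * s 1 1 x₀) :
    ¬ IsLocalMax (fun y => (s 0 1 y ^ 2 - s 0 0 y * s 1 1 y) /
      (g 0 0 y * g 1 1 y - g 0 1 y ^ 2)) x₀ := by
  intro hmax
  set f : Plane → ℝ := fun y => (s 0 1 y ^ 2 - s 0 0 y * s 1 1 y) /
      (g 0 0 y * g 1 1 y - g 0 1 y ^ 2) with hf
  set D : Plane → ℝ := fun y => g 0 0 y * g 1 1 y - g 0 1 y * g 0 1 y with hDdef
  set T := covDer G s with hT
  have hD' : ∀ y ∈ U, 0 < D y := fun y hy => by simpa [hDdef, sq] using hD y hy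
  have sD : ContDiffOn ℝ ∞ D U := ((hg 0 0).mul (hg 1 1)).sub ((hg 0 1).mul (hg 0 1))
  have sf : ContDiffOn ℝ ∞ f U :=
    (((hs 0 1).pow 2).sub ((hs 0 0).mul (hs 1 1))).div
      (((hg 0 0).mul (hg 1 1)).sub ((hg 0 1).pow 2)) fun y hy => (hD y hy).ne'
  have sT : ∀ K M N, ContDiffOn ℝ ∞ (T K M N) U := contDiffOn_covDer hU hG hs
  have dg := fun M N {y} (hy : y ∈ U) => differentiableAt_of_contDiffOn hU hy (hg M N)
  have ds := fun M N {y} (hy : y ∈ U) => differentiableAt_of_contDiffOn hU hy (hs M N)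
  have dT := fun K M N {y} (hy : y ∈ U) => differentiableAt_of_contDiffOn hU hy (sT K M N)
  have dD := fun {y} (hy : y ∈ U) => differentiableAt_of_contDiffOn hU hy sD
  have df := fun {y} (hy : y ∈ U) => differentiableAt_of_contDiffOn hU hy sf
  have dpf := fun K {y} (hy : y ∈ U) =>
    differentiableAt_of_contDiffOn hU hy (contDiffOn_pd hU sf K)
  -- first derivatives
  have pg : ∀ y ∈ U, ∀ K M N, pd K (g M N) y = G 0 K M y * g 0 N y + G 1 K M y * g 1 N y
      + (G 0 K N y * g M 0 y + G 1 K N y * g M 1 y) := fun y hy K M N => by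
    have := hcompat y hy K M N
    simp only [covDer, Fin.sum_univ_two] at this
    linarith
  have ps : ∀ y, ∀ K M N, pd K (s M N) y = T K M N y + G 0 K M y * s 0 N y + G 1 K M y * s 1 N y
      + (G 0 K N y * s M 0 y + G 1 K N y * s M 1 y) := fun y K M N => by
    simp only [hT, covDer, Fin.sum_univ_two]
    ring
  have fD : ∀ y ∈ U, f y * D y = s 0 1 y * s 0 1 y - s 0 0 y * s 1 1 y := fun y hy => by
    simp only [hf, hDdef, ← sq]
    exact div_mul_cancel₀ _ (hD y hy).ne'
  have pf : ∀ y ∈ U, ∀ K, pd K f y * D y =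
      2 * s 0 1 y * T K 0 1 y - s 0 0 y * T K 1 1 y - s 1 1 y * T K 0 0 y := fun y hy K => by
    have h1 := pd_congr K hU hy fD
    rw [pd_mul _ (df hy) (dD hy),
      pd_sub _ ((ds 0 1 hy).fun_mul (ds 0 1 hy)) ((ds 0 0 hy).fun_mul (ds 1 1 hy)),
      pd_mul _ (ds 0 1 hy) (ds 0 1 hy), pd_mul _ (ds 0 0 hy) (ds 1 1 hy)] at h1
    -- Metric compatibility: the logarithmic derivative of det g is twice the contracted connection
    -- coefficient. The same factor arises from det s, so it cancels in `pf`.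
    have h2 : pd K D y = 2 * (G 0 K 0 y + G 1 K 1 y) * D y := by
      rw [hDdef, pd_sub _ ((dg 0 0 hy).fun_mul (dg 1 1 hy)) ((dg 0 1 hy).fun_mul (dg 0 1 hy)),
        pd_mul _ (dg 0 0 hy) (dg 1 1 hy), pd_mul _ (dg 0 1 hy) (dg 0 1 hy)]
      simp only [pg y hy, hgs]
      ring
    simp only [h2, ps, hss] at h1
    linear_combination h1 - 2 * (G 0 K 0 y + G 1 K 1 y) * fD y hy
  have trT : ∀ y ∈ U, ∀ K,
      g 1 1 y * T K 0 0 y - 2 * g 0 1 y * T K 0 1 y - (-1 * g 0 0 y) * T K 1 1 y = 0 :=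
      fun y hy K => by
    have h1 := pd_congr (f := fun y => g 1 1 y * s 0 0 y - 2 * g 0 1 y * s 0 1 y
      - (-1 * g 0 0 y) * s 1 1 y) (g := fun _ => 0) K hU hy
      (fun z hz => by linarith [htr z hz])
    rw [pd_combination (dg 1 1 hy) ((dg 0 1 hy).const_mul 2) ((dg 0 0 hy).const_mul (-1))
      (ds 0 0 hy) (ds 0 1 hy) (ds 1 1 hy), pd_const, pd_const_mul _ _ (dg 0 1 hy),
      pd_const_mul _ _ (dg 0 0 hy)] at h1
    simp only [ps, pg y hy, hss, hgs] at h1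
    linear_combination h1 - 2 * (G 0 K 0 y + G 1 K 1 y) * htr y hy
  -- `∇s = 0` at the maximum
  have Ts : ∀ K, T K 1 0 = T K 0 1 := fun K => by
    funext y
    simp only [hT, covDer, Fin.sum_univ_two, hss]
    ring
  have Tc : ∀ y ∈ U, ∀ M N P, T M N P y = T N M P y := hcod
  have T1 : ∀ y ∈ U, T 1 0 0 y = T 0 0 1 y := fun y hy => by rw [Tc y hy, Ts]
  have T2 : ∀ y ∈ U, T 1 0 1 y = T 0 1 1 y := fun y hy => Tc y hy _ _ _
  have hcrit : ∀ K, pd K f x₀ = 0 := pd_eq_zero_of_isLocalMax hmax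
  have hT0 : T 0 0 0 x₀ = 0 ∧ T 0 0 1 x₀ = 0 ∧ T 0 1 1 x₀ = 0 ∧ T 1 1 1 x₀ = 0 := by
    have a0 := trT x₀ hx₀ 0
    have a1 := trT x₀ hx₀ 1
    have b0 := pf x₀ hx₀ 0
    have b1 := pf x₀ hx₀ 1
    rw [hcrit] at b0 b1
    rw [T1 x₀ hx₀, T2 x₀ hx₀] at a1 b1
    -- The two trace conditions and the two equations df = 0 are four linear equations for the four
    -- independent components 000, 001, 011, 111 of ∇s.
    exact cubic_eq_zero (hD x₀ hx₀) hF (htr x₀ hx₀) (by linear_combination a0)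
      (by linear_combination a1) (by linear_combination b0) (by linear_combination b1)
  have T0 : ∀ K M N, T K M N x₀ = 0 := by
    obtain ⟨h1, h2, h3, h4⟩ := hT0
    intro K M N
    fin_cases K <;> fin_cases M <;> fin_cases N <;>
      simp [Ts, T1 x₀ hx₀, T2 x₀ hx₀, h1, h2, h3, h4]
  -- second derivatives at the maximum
  have trT' : ∀ L K, g 1 1 x₀ * pd L (T K 0 0) x₀ - 2 * g 0 1 x₀ * pd L (T K 0 1) x₀
      + g 0 0 x₀ * pd L (T K 1 1) x₀ = 0 := fun L K => by
    have h1 := pd_congr (g := fun _ => 0) L hU hx₀ (fun z hz => trT z hz K)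
    rw [pd_combination (dg 1 1 hx₀) ((dg 0 1 hx₀).const_mul 2) ((dg 0 0 hx₀).const_mul (-1))
      (dT K 0 0 hx₀) (dT K 0 1 hx₀) (dT K 1 1 hx₀), pd_const] at h1
    simp only [T0] at h1
    linear_combination h1
  have hessf : ∀ L K, pd L (pd K f) x₀ * D x₀ = 2 * s 0 1 x₀ * pd L (T K 0 1) x₀
      - s 0 0 x₀ * pd L (T K 1 1) x₀ - s 1 1 x₀ * pd L (T K 0 0) x₀ := fun L K => by
    have h1 := pd_congr L hU hx₀ (fun z hz => pf z hz K)
    rw [pd_combination ((ds 0 1 hx₀).const_mul 2) (ds 0 0 hx₀) (ds 1 1 hx₀)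
      (dT K 0 1 hx₀) (dT K 1 1 hx₀) (dT K 0 0 hx₀), pd_mul _ (dpf K hx₀) (dD hx₀)] at h1
    simp only [T0, hcrit] at h1
    linear_combination h1
  have pT1 : ∀ L, pd L (T 1 0 0) x₀ = pd L (T 0 0 1) x₀ := fun L => pd_congr L hU hx₀ T1
  have pT2 : ∀ L, pd L (T 1 0 1) x₀ = pd L (T 0 1 1) x₀ := fun L => pd_congr L hU hx₀ T2
  -- The Ricci identity for `g` itself, whose covariant derivative vanishes on all of `U`, yields
  -- the skewness of the lowered curvature.
  have cg : ∀ M N, curv G 0 M x₀ * g 0 N x₀ + curv G 0 N x₀ * g M 0 x₀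
      + (curv G 1 M x₀ * g 1 N x₀ + curv G 1 N x₀ * g M 1 x₀) = 0 := fun M N => by
    have h1 := ricci_identity hU hx₀ hG hg (hcompat x₀ hx₀) M N
    have h2 : ∀ J K, pd J (covDer G g K M N) x₀ = 0 := fun J K => by
      rw [pd_congr (g := fun _ => 0) J hU hx₀ (fun z hz => hcompat z hz K M N), pd_const]
    rw [h2, h2] at h1
    simp only [Fin.sum_univ_two] at h1
    linear_combination h1
  have cs : ∀ M N, pd 0 (T 1 M N) x₀ - pd 1 (T 0 M N) x₀ =
      -(curv G 0 M x₀ * s 0 N x₀ + curv G 0 N x₀ * s M 0 x₀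
      + (curv G 1 M x₀ * s 1 N x₀ + curv G 1 N x₀ * s M 1 x₀)) := fun M N => by
    have h1 := ricci_identity hU hx₀ hG hs T0 M N
    simp only [Fin.sum_univ_two] at h1
    exact h1
  have g00 := cg 0 0
  have g01 := cg 0 1
  have g11 := cg 1 1
  have s00 := cs 0 0
  have s01 := cs 0 1
  have s11 := cs 1 1
  simp only [hgs] at g00 g01 g11
  simp only [hss, pT1, pT2] at s00 s01 s11
  have h1 := fun L => trT' L 0
  have h2 := fun L => trT' L 1
  simp only [pT1, pT2] at h2
  have key := bochner_algebra (a := fun L => pd L (T 0 0 0) x₀) (b := fun L => pd L (T 0 0 1) x₀)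
    (c := fun L => pd L (T 0 1 1) x₀) (d := fun L => pd L (T 1 1 1) x₀)
    (W := fun L M => curv G L M x₀) (hD x₀ hx₀).ne' (htr x₀ hx₀) h1 h2
    (by linear_combination g00 / 2) (by linear_combination g01) (by linear_combination g11 / 2)
    hric (by linear_combination s00) (by linear_combination s01) (by linear_combination s11)
  -- The vectors (-g₀₁, g₀₀) and (1, 0) are g-orthogonal. The Hessian on the first plus `D x₀` times
  -- the Hessian on the second is g₀₀ · det g times the g-trace of the Hessian.
  have hess1 := hessian_nonpos_of_isLocalMax hU hx₀ sf hmax ![-g 0 1 x₀, g 0 0 x₀]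
  have hess2 := hessian_nonpos_of_isLocalMax hU hx₀ sf hmax ![1, 0]
  have k00 := hessf 0 0
  have k01 := hessf 0 1
  have k10 := hessf 1 0
  have k11 := hessf 1 1
  simp only [pT1, pT2] at k01 k11
  simp only [Fin.sum_univ_two, Matrix.cons_val_zero, Matrix.cons_val_one] at hess1 hess2
  simp only [← k00, ← k01, ← k10, ← k11] at key
  have hDx := hD' x₀ hx₀
  have hDe : D x₀ = g 0 0 x₀ * g 1 1 x₀ - g 0 1 x₀ ^ 2 := by simp only [hDdef]; ring
  rw [← hDe] at key
  have hcontr : g 0 0 x₀ * (g 1 1 x₀ * pd 0 (pd 0 f) x₀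
      - g 0 1 x₀ * (pd 0 (pd 1 f) x₀ + pd 1 (pd 0 f) x₀) + g 0 0 x₀ * pd 1 (pd 1 f) x₀) ≤ 0 := by
    have := mul_nonpos_of_nonneg_of_nonpos hDx.le hess2
    rw [hDe] at this
    linarith
  have key' : g 1 1 x₀ * pd 0 (pd 0 f) x₀
      - g 0 1 x₀ * (pd 0 (pd 1 f) x₀ + pd 1 (pd 0 f) x₀) + g 0 0 x₀ * pd 1 (pd 1 f) x₀
      = 2 * R * (s 0 1 x₀ ^ 2 - s 0 0 x₀ * s 1 1 x₀) :=
    mul_right_cancel₀ hDx.ne' (by linear_combination key)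
  rw [key'] at hcontr
  have : 0 < g 0 0 x₀ * (2 * R * (s 0 1 x₀ ^ 2 - s 0 0 x₀ * s 1 1 x₀)) := by positivity
  linarith

/-! ### The Levi-Civita connection and curvature of the metric in a chart. -/

section LeviCivita

variable (q : Metric2) (e : OpenPartialHomeomorph S2 Plane)

theorem metricComp_symm : metricComp q e 1 0 = metricComp q e 0 1 :=
  funext fun _ => q.symm _ _ _

theorem christoffel_symm (L : Fin 2) : christoffel q e L 1 0 = christoffel q e L 0 1 := by
  funext x
  simp only [christoffel, Fin.sum_univ_two, metricComp_symm]
  ring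

theorem invMetric_eq (x : Plane) :
    invMetric q e 0 0 x = metricComp q e 1 1 x /
        (metricComp q e 0 0 x * metricComp q e 1 1 x - metricComp q e 0 1 x ^ 2) ∧
      invMetric q e 0 1 x = -metricComp q e 0 1 x /
        (metricComp q e 0 0 x * metricComp q e 1 1 x - metricComp q e 0 1 x ^ 2) ∧
      invMetric q e 1 0 x = -metricComp q e 0 1 x /
        (metricComp q e 0 0 x * metricComp q e 1 1 x - metricComp q e 0 1 x ^ 2) ∧
      invMetric q e 1 1 x = metricComp q e 0 0 x /
        (metricComp q e 0 0 x * metricComp q e 1 1 x - metricComp q e 0 1 x ^ 2) := by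
  simp only [invMetric, Matrix.inv_def, Matrix.adjugate_fin_two, Matrix.det_fin_two,
    Ring.inverse_eq_inv', Matrix.smul_apply, Matrix.of_apply, smul_eq_mul, metricComp_symm, sq]
  refine ⟨?_, ?_, ?_, ?_⟩ <;> simp [div_eq_inv_mul]

variable {e} (he : IsCoord e) {x : Plane} (hx : x ∈ e.target)

include he hx

theorem metricComp_pos_pos : 0 < metricComp q e 0 0 x ∧
    0 < metricComp q e 0 0 x * metricComp q e 1 1 x - metricComp q e 0 1 x ^ 2 := by
  have h (a b : ℝ) (hab : a ≠ 0 ∨ b ≠ 0) : 0 < a ^ 2 * metricComp q e 0 0 x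
      + 2 * a * b * metricComp q e 0 1 x + b ^ 2 * metricComp q e 1 1 x := by
    have hpos := q.pos (e.symm x) (a • coordVec e 0 x + b • coordVec e 1 x) (fun h0 => by
      have := coordVec_linearIndependent he hx h0
      tauto)
    have hs : q.inner (e.symm x) (coordVec e 1 x) (coordVec e 0 x) =
      q.inner (e.symm x) (coordVec e 0 x) (coordVec e 1 x) := q.symm _ _ _
    simp only [map_add, map_smul, add_apply, smul_apply, smul_eq_mul, hs] at hpos
    simp only [metricComp, comp]
    linarith
  have h0 : 0 < metricComp q e 0 0 x := by simpa using h 1 0 (by simp)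
  refine ⟨h0, pos_of_mul_pos_right (a := metricComp q e 0 0 x) ?_ h0.le⟩
  -- On the vector (-g₀₁, g₀₀) the quadratic form takes the value g₀₀ · det g.
  have := h (-metricComp q e 0 1 x) (metricComp q e 0 0 x) (Or.inr h0.ne')
  linarith

omit hx in
theorem contDiffOn_metricComp (M N : Fin 2) : ContDiffOn ℝ ∞ (metricComp q e M N) e.target :=
  contDiffOn_comp he q.contMDiff M N

omit hx in
theorem contDiffOn_invMetric (M N : Fin 2) : ContDiffOn ℝ ∞ (invMetric q e M N) e.target := by
  have h := contDiffOn_metricComp q he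
  have hD : ContDiffOn ℝ ∞ (fun x => metricComp q e 0 0 x * metricComp q e 1 1 x
      - metricComp q e 0 1 x ^ 2) e.target := ((h 0 0).mul (h 1 1)).sub ((h 0 1).pow 2)
  have hne : ∀ x ∈ e.target, metricComp q e 0 0 x * metricComp q e 1 1 x
      - metricComp q e 0 1 x ^ 2 ≠ 0 := fun x hx => (metricComp_pos_pos q he hx).2.ne'
  have hi := invMetric_eq q e
  fin_cases M <;> fin_cases N
  · exact ((h 1 1).div hD hne).congr fun x _ => (hi x).1
  · exact ((h 0 1).neg.div hD hne).congr fun x _ => (hi x).2.1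
  · exact ((h 0 1).neg.div hD hne).congr fun x _ => (hi x).2.2.1
  · exact ((h 0 0).div hD hne).congr fun x _ => (hi x).2.2.2

omit hx in
theorem contDiffOn_christoffel (L M N : Fin 2) :
    ContDiffOn ℝ ∞ (christoffel q e L M N) e.target :=
  contDiffOn_const.mul (ContDiffOn.sum fun P _ => (contDiffOn_invMetric q he L P).mul
    (((contDiffOn_pd e.open_target (contDiffOn_metricComp q he N P) M).add
      (contDiffOn_pd e.open_target (contDiffOn_metricComp q he M P) N)).sub
      (contDiffOn_pd e.open_target (contDiffOn_metricComp q he M N) P)))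

/-- Lowering the upper index of Γ cancels the inverse metric, and the two lowered symbols then add
up to the partial derivative of the metric component. -/
theorem covDer_metricComp (K M N : Fin 2) :
    covDer (christoffel q e) (metricComp q e) K M N x = 0 := by
  have hD := (metricComp_pos_pos q he hx).2.ne'
  obtain ⟨h1, h2, h3, h4⟩ := invMetric_eq q e x
  -- Naming the determinant lets `field_simp` clear it as one nonzero atom; it is expanded again
  -- only for `ring`.
  obtain ⟨d, hd⟩ : ∃ d, d = metricComp q e 0 0 x * metricComp q e 1 1 x
    - metricComp q e 0 1 x ^ 2 := ⟨_, rfl⟩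
  rw [← hd] at hD h1 h2 h3 h4
  simp only [covDer, christoffel, Fin.sum_univ_two, h1, h2, h3, h4]
  fin_cases K <;> fin_cases M <;> fin_cases N <;>
    simp only [Fin.zero_eta, Fin.mk_one, metricComp_symm] <;> field_simp <;>
    rw [hd] <;> ring

/-- The scalar curvature in terms of the curvature components `R^L_{M01}`. -/
theorem scalarCurvature_eq :
    -metricComp q e 1 1 x * curv (christoffel q e) 1 0 x
      - metricComp q e 0 1 x * (curv (christoffel q e) 0 0 x - curv (christoffel q e) 1 1 x)
      + metricComp q e 0 0 x * curv (christoffel q e) 0 1 x =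
    scalarCurvature q e x *
      (metricComp q e 0 0 x * metricComp q e 1 1 x - metricComp q e 0 1 x ^ 2) := by
  have hD := (metricComp_pos_pos q he hx).2.ne'
  obtain ⟨h1, h2, h3, h4⟩ := invMetric_eq q e x
  obtain ⟨d, hd⟩ : ∃ d, d = metricComp q e 0 0 x * metricComp q e 1 1 x
    - metricComp q e 0 1 x ^ 2 := ⟨_, rfl⟩
  rw [← hd] at hD h1 h2 h3 h4
  simp only [scalarCurvature, ricci, curv, Fin.sum_univ_two, h1, h2, h3, h4, christoffel_symm, ← hd]
  field_simp
  ring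

theorem trace_eq {b : (p : S2) → BilinAt p} (hb : ∀ p v w, b p v w = b p w v) :
    metricComp q e 1 1 x * comp e b 0 0 x - 2 * metricComp q e 0 1 x * comp e b 0 1 x
      + metricComp q e 0 0 x * comp e b 1 1 x =
    trace q e b x *
      (metricComp q e 0 0 x * metricComp q e 1 1 x - metricComp q e 0 1 x ^ 2) := by
  have hD := (metricComp_pos_pos q he hx).2.ne'
  obtain ⟨h1, h2, h3, h4⟩ := invMetric_eq q e x
  obtain ⟨d, hd⟩ : ∃ d, d = metricComp q e 0 0 x * metricComp q e 1 1 x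
    - metricComp q e 0 1 x ^ 2 := ⟨_, rfl⟩
  rw [← hd] at hD h1 h2 h3 h4
  have hs : comp e b 1 0 x = comp e b 0 1 x := hb _ _ _
  simp only [trace, Fin.sum_univ_two, h1, h2, h3, h4, hs, ← hd]
  field_simp
  ring

end LeviCivita

/-! ### The frame-independent function f on the sphere. -/

section DetRatio

/-- Minus the determinant of a bilinear form `b` relative to that of the metric; for a trace-free
symmetric form this is half its squared norm. -/
noncomputable def negDetRatio (q : Metric2) (b : (p : S2) → BilinAt p) (p : S2) : ℝ :=
  let v : Fin 2 → TangentSpace (𝓡 2) p := fun M => (EuclideanSpace.single M (1 : ℝ) : Plane)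
  (b p (v 0) (v 1) ^ 2 - b p (v 0) (v 0) * b p (v 1) (v 1)) /
    (q.inner p (v 0) (v 0) * q.inner p (v 1) (v 1) - q.inner p (v 0) (v 1) ^ 2)

/-- Under a change of frame both determinants are multiplied by the square of the determinant of the
change, so the ratio can be computed in any chart. -/
theorem negDetRatio_symm_apply (q : Metric2) {e : OpenPartialHomeomorph S2 Plane}
    (he : IsCoord e) {b : (p : S2) → BilinAt p} (hb : ∀ p v w, b p v w = b p w v)
    {x : Plane} (hx : x ∈ e.target) :
    negDetRatio q b (e.symm x) =
      (comp e b 0 1 x ^ 2 - comp e b 0 0 x * comp e b 1 1 x) /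
        (metricComp q e 0 0 x * metricComp q e 1 1 x - metricComp q e 0 1 x ^ 2) := by
  have hD := (metricComp_pos_pos q he hx).2
  set v : Fin 2 → TangentSpace (𝓡 2) (e.symm x) :=
    fun M => (EuclideanSpace.single M (1 : ℝ) : Plane) with hv
  have hbasis : ∀ w : TangentSpace (𝓡 2) (e.symm x), ∃ a c : ℝ, w = a • v 0 + c • v 1 := by
    intro w
    have h : ∀ z : Plane, z = z 0 • EuclideanSpace.single 0 (1 : ℝ)
        + z 1 • EuclideanSpace.single 1 (1 : ℝ) := fun z => by
      ext i
      fin_cases i <;> simp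
    exact ⟨_, _, h w⟩
  obtain ⟨a₀, c₀, h0⟩ := hbasis (coordVec e 0 x)
  obtain ⟨a₁, c₁, h1⟩ := hbasis (coordVec e 1 x)
  have hexp : ∀ B : BilinAt (e.symm x), (∀ v w, B v w = B w v) →
      B (coordVec e 0 x) (coordVec e 1 x) ^ 2
        - B (coordVec e 0 x) (coordVec e 0 x) * B (coordVec e 1 x) (coordVec e 1 x) =
      (a₀ * c₁ - a₁ * c₀) ^ 2 * (B (v 0) (v 1) ^ 2 - B (v 0) (v 0) * B (v 1) (v 1)) := by
    intro B hB
    rw [h0, h1]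
    simp only [map_add, map_smul, add_apply, smul_apply, smul_eq_mul, hB (v 1) (v 0)]
    ring
  have hq := hexp (q.inner (e.symm x)) (q.symm _)
  have hb' := hexp (b (e.symm x)) (hb _)
  simp only [metricComp, comp] at hD ⊢
  -- A degenerate change of frame would make the metric determinant in the chart `e` vanish, against
  -- `hD`.
  have hne : (a₀ * c₁ - a₁ * c₀) ^ 2 ≠ 0 := by
    intro h
    rw [h] at hq
    linarith
  rw [hb', ← neg_sub (_ ^ 2) (_ * _), hq, ← mul_neg, neg_sub, mul_div_mul_left _ _ hne]
  rfl

end DetRatio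

/-! ### From the local statement to the whole sphere. -/

theorem exists_eq_coordVec {e : OpenPartialHomeomorph S2 Plane} (he : IsCoord e)
    {x : Plane} (hx : x ∈ e.target) (w : TangentSpace (𝓡 2) (e.symm x)) :
    ∃ a b : ℝ, w = a • coordVec e 0 x + b • coordVec e 1 x := by
  let A : Plane →L[ℝ] Plane := id (mfderiv 𝓘(ℝ, Plane) (𝓡 2) e.symm x)
  have hA : Function.Surjective A :=
    (LinearMap.injective_iff_surjective (f := A.toLinearMap)).mp
      (mfderiv_chart_symm_injective he hx)
  obtain ⟨z, hz⟩ := hA w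
  have h : z = z 0 • EuclideanSpace.single 0 (1 : ℝ)
      + z 1 • EuclideanSpace.single 1 (1 : ℝ) := by
    ext i
    fin_cases i <;> simp
  refine ⟨z 0, z 1, hz.symm.trans ?_⟩
  conv_lhs => rw [h, map_add, map_smul, map_smul]
  rfl

variable {q : Metric2} {b : (p : S2) → BilinAt p}

/-- A trace-free symmetric form with nonnegative determinant vanishes. -/
theorem eq_zero_of_negDetRatio_nonpos {e : OpenPartialHomeomorph S2 Plane} (he : IsCoord e)
    (hb : ∀ p v w, b p v w = b p w v) {x : Plane} (hx : x ∈ e.target)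
    (htr : trace q e b x = 0) (h : negDetRatio q b (e.symm x) ≤ 0) : b (e.symm x) = 0 := by
  obtain ⟨hpos, hD⟩ := metricComp_pos_pos q he hx
  have ht := trace_eq q he hx hb
  rw [htr, zero_mul] at ht
  rw [negDetRatio_symm_apply q he hb hx, div_nonpos_iff] at h
  have hF : comp e b 0 1 x ^ 2 - comp e b 0 0 x * comp e b 1 1 x ≤ 0 := by
    rcases h with h | h
    · exact absurd h.2 (not_le.mpr hD)
    · exact h.1
  -- Completing the square, with the trace condition eliminating the 11 component, writes g₀₀² (s₀₁²
  -- - s₀₀ s₁₁) as a sum of two nonnegative terms.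
  have hsq : (metricComp q e 0 0 x * comp e b 0 1 x - metricComp q e 0 1 x * comp e b 0 0 x) ^ 2
      + (metricComp q e 0 0 x * metricComp q e 1 1 x - metricComp q e 0 1 x ^ 2)
        * comp e b 0 0 x ^ 2 ≤ 0 := by
    have : (metricComp q e 0 0 x * comp e b 0 1 x - metricComp q e 0 1 x * comp e b 0 0 x) ^ 2
      + (metricComp q e 0 0 x * metricComp q e 1 1 x - metricComp q e 0 1 x ^ 2)
        * comp e b 0 0 x ^ 2 = metricComp q e 0 0 x ^ 2
        * (comp e b 0 1 x ^ 2 - comp e b 0 0 x * comp e b 1 1 x) := by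
      linear_combination metricComp q e 0 0 x * comp e b 0 0 x * ht
    rw [this]
    exact mul_nonpos_of_nonneg_of_nonpos (sq_nonneg _) hF
  have h00 : comp e b 0 0 x = 0 := by
    by_contra hne
    have := mul_pos hD (pow_pos (abs_pos.mpr hne) 2)
    rw [sq_abs] at this
    nlinarith [sq_nonneg (metricComp q e 0 0 x * comp e b 0 1 x
      - metricComp q e 0 1 x * comp e b 0 0 x)]
  have h01 : comp e b 0 1 x = 0 := by
    rw [h00] at hF
    exact pow_eq_zero_iff two_ne_zero |>.mp (le_antisymm (by linarith) (sq_nonneg _))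
  have h11 : comp e b 1 1 x = 0 := by
    rw [h00, h01] at ht
    exact (mul_eq_zero_iff_left hpos.ne').mp (by linarith)
  have h10 : comp e b 1 0 x = 0 := (hb _ _ _).trans h01
  ext v w
  obtain ⟨a₁, c₁, rfl⟩ := exists_eq_coordVec he hx v
  obtain ⟨a₂, c₂, rfl⟩ := exists_eq_coordVec he hx w
  simp only [comp] at h00 h01 h11 h10
  simp [h00, h01, h11, h10]

theorem isCoord_chartAt (p : S2) : IsCoord (chartAt Plane p) :=
  IsManifold.chart_mem_maximalAtlas p

/-- The frame in the definition of `negDetRatio` need not vary continuously with the point, so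
continuity is read off from the smooth components in a fixed chart near each point. -/
theorem continuous_negDetRatio
    (hs : ContMDiff (𝓡 2) ((𝓡 2).prod 𝓘(ℝ, Plane →L[ℝ] Plane →L[ℝ] ℝ)) ∞
      (fun p : S2 => (Bundle.TotalSpace.mk' (Plane →L[ℝ] Plane →L[ℝ] ℝ) p (b p) :
        Bundle.TotalSpace (Plane →L[ℝ] Plane →L[ℝ] ℝ) BilinAt)))
    (hb : ∀ p v w, b p v w = b p w v) : Continuous (negDetRatio q b) := by
  rw [continuous_iff_continuousAt]
  intro p
  have he := isCoord_chartAt p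
  set e := chartAt Plane p
  have hp : p ∈ e.source := mem_chart_source Plane p
  have c1 := fun M N => (contDiffOn_comp he hs M N).continuousOn
  have c2 := fun M N => (contDiffOn_metricComp q he M N).continuousOn
  have h : ContinuousOn (fun x => (comp e b 0 1 x ^ 2 - comp e b 0 0 x * comp e b 1 1 x) /
      (metricComp q e 0 0 x * metricComp q e 1 1 x - metricComp q e 0 1 x ^ 2)) e.target :=
    (((c1 0 1).pow 2).sub ((c1 0 0).mul (c1 1 1))).div
      (((c2 0 0).mul (c2 1 1)).sub ((c2 0 1).pow 2))
      fun x hx => (metricComp_pos_pos q he hx).2.ne'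
  have h' := h.comp e.continuousOn e.mapsTo
  refine ((h'.congr fun y hy => ?_).continuousAt (e.open_source.mem_nhds hp))
  rw [Function.comp_apply, ← negDetRatio_symm_apply q he hb (e.map_source hy), e.left_inv hy]

/-- The negated determinant of a trace-free Codazzi tensor is nowhere positive. -/
theorem negDetRatio_nonpos {R : ℝ} (hR : 0 < R) (hq : HasConstScalarCurvature q R)
    (hs : ContMDiff (𝓡 2) ((𝓡 2).prod 𝓘(ℝ, Plane →L[ℝ] Plane →L[ℝ] ℝ)) ∞
      (fun p : S2 => (Bundle.TotalSpace.mk' (Plane →L[ℝ] Plane →L[ℝ] ℝ) p (b p) :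
        Bundle.TotalSpace (Plane →L[ℝ] Plane →L[ℝ] ℝ) BilinAt)))
    (hb : ∀ p v w, b p v w = b p w v)
    (hcod : ∀ e, IsCoord e → ∀ x ∈ e.target, ∀ M N P : Fin 2,
      covDeriv q e b M N P x - covDeriv q e b N M P x = 0)
    (htr : ∀ e, IsCoord e → ∀ x ∈ e.target, trace q e b x = 0) (p : S2) :
    negDetRatio q b p ≤ 0 := by
  obtain ⟨p₀, -, hmax⟩ := isCompact_univ.exists_isMaxOn ⟨p, Set.mem_univ p⟩
    (continuous_negDetRatio (q := q) hs hb).continuousOn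
  refine (hmax (Set.mem_univ p)).trans ?_
  have he := isCoord_chartAt p₀
  set e := chartAt Plane p₀
  have hp : p₀ ∈ e.source := mem_chart_source Plane p₀
  have hx := e.map_source hp
  set x₀ : Plane := e p₀ with hx₀
  have hval := fun x (hx : x ∈ e.target) => negDetRatio_symm_apply q he hb hx
  by_contra hneg
  rw [not_le, ← e.left_inv hp, ← hx₀, hval _ hx] at hneg
  have hF := (div_pos_iff_of_pos_right (metricComp_pos_pos q he hx).2).mp hneg
  -- Constancy of the scalar curvature supplies its value at the maximum, and the global maximum
  -- over the sphere is a local one in the chart.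
  refine not_isLocalMax_of_codazzi e.open_target hx (contDiffOn_christoffel q he)
    (contDiffOn_metricComp q he) (contDiffOn_comp he hs) (metricComp_symm q e)
    (funext fun _ => hb _ _ _) (fun y hy => covDer_metricComp q he hy)
    (fun y hy M N P => sub_eq_zero.mp (hcod e he y hy M N P)) (metricComp_pos_pos q he hx).1
    (fun y hy => (metricComp_pos_pos q he hy).2)
    (fun y hy => by rw [trace_eq q he hy hb, htr e he y hy, zero_mul])
    (by rw [scalarCurvature_eq q he hx, hq e he _ hx]) hR hF ?_
  filter_upwards [e.open_target.mem_nhds hx] with y hy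
  rw [← hval y hy, ← hval x₀ hx, hx₀, e.left_inv hp]
  exact hmax (Set.mem_univ _)

end Scri

theorem mainTheorem7 (q : Scri.Metric2) (R : ℝ) (hR : 0 < R)
    (hq : Scri.HasConstScalarCurvature q R)
    (σ : Scri.SpatialTensor) (hsmooth : σ.Smooth) (hsymm : σ.IsSymm)
    (hnull : σ.NullDerivZero) (hcodazzi : σ.IsCodazzi q) (htrace : σ.IsTraceless q) :
    ∀ (u : ℝ) (p : Scri.S2), σ u p = 0 := by
  intro u p
  have he := Scri.isCoord_chartAt p
  have hp := mem_chart_source Scri.Plane p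
  have h := Scri.eq_zero_of_negDetRatio_nonpos (q := q) (b := σ u) he (hsymm u)
    ((chartAt Scri.Plane p).map_source hp)
    (htrace u _ he _ ((chartAt Scri.Plane p).map_source hp))
    (Scri.negDetRatio_nonpos hR hq (hsmooth.contMDiff u) (hsymm u) (hcodazzi u) (htrace u) _)
  rwa [(chartAt Scri.Plane p).left_inv hp] at h
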